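/- Let $(\xi_t)_{t\ge1}$ be i.i.d. random variables with values in the nonnegative integers such that $\mathbb P(\xi_1\ge 1)=1$ and $\mathbb E\,\xi_1^{1+\delta}<\infty$ for some $\delta>0$, and let $(\theta_t)_{t\ge1}$ be i.i.d. uniform on $[0,1]$, independent of $(\xi_t)_{t\ge1}$. Define random finite directed graphs $G_t$ $(t\ge 0)$ as follows. $G_0$ is the single vertex $0$ (the root) without edges; for $t\ge1$, $G_t$ is obtained from $G_{t-1}$ by adding a vertex $t$ and one directed edge from $t$ to a vertex $f_{\mathrm{Nak}}(G_{(t-\xi_t)_+},\theta_t)$, where $f_{\mathrm{Nak}}(G,\theta)$ (the Nakamoto construction) is chosen uniformly, by means of $\theta$, among the vertices of $G$ at maximal hop distance from the root; explicitly, if $v_0<\dots<v_{m-1}$ are these vertices, then $f_{\mathrm{Nak}}(G,u)=v_{\min(\lfloor um\rfloor,\,m-1)}$. Let $\overline{\mathcal B}$ be the set of all locally finite, connected directed acyclic graphs whose vertices are nonnegative integers, with root $0$, and put $d_*(G,H)=\frac1{1+s}$, where $s\in\{0,1,\dots,\infty\}$ is the supremum of all integers $n$ such that the balls of radius $n$ (in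 hop distance) around the roots of $G$ and $H$ coincide as labelled directed graphs ($d_*=0$ if $s=\infty$). A ray in a directed graph is a semi-infinite directed path; two rays $p_1,p_2$ are equivalent if there is a ray $p_3$ having infinitely many vertices in common with $p_1$ and infinitely many with $p_2$; a graph is one-ended if it has a ray and any two of its rays are equivalent. A vertex $v$ is confirmed if for all but finitely many vertices $w>v$ there is a directed path from $w$ to $v$. Then, almost surely, there is a graph $G_\infty(f_{\mathrm{Nak}})\in\overline{\mathcal B}$ with $d_*(G_t,G_\infty(f_{\mathrm{Nak}}))\to0$ as $t\to\infty$; it is one-ended, it is a tree with all edges directed towards the root, and it has infinitely many confirmed vertices. Moreover, let $r=\min\{n:\mathbb P(\xi_1=n)>0\}$ and call $[t,t+r)$ a regeneration interval if $\xi_{t+s}=r$ for $0\le s<r$ and $\xi_{t+s}\le s$ for all $s\ge r$. Then, almost surely, there are infinitely many $t\ge1$ such that $[t,t+r)$ and $[t+r,t+2r)$ are both regeneration intervals. -/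

import Mathlib

open scoped ENNReal

/-- A directed graph whose vertices are identified with their marks, which are natural numbers.
The root is always the vertex `0`.  An edge `edge u v` points from `u` to `v`. -/
@[ext]
structure MarkedDigraph where
  verts : Set ℕ
  edge : ℕ → ℕ → Prop

namespace MarkedDigraph

/-- The underlying undirected graph (on all of `ℕ`; only `verts` matters). -/
def undirected (G : MarkedDigraph) : SimpleGraph ℕ :=
  SimpleGraph.fromRel G.edge

/-- Directed path of positive length from `u` to `v`. -/
def Reaches (G : MarkedDigraph) (u v : ℕ) : Prop :=
  Relation.TransGen G.edge u v

/-- Rooted, connected, locally finite directed acyclic graphs (finite or infinite). -/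
structure IsBlockDAG (G : MarkedDigraph) : Prop where
  root_mem : 0 ∈ G.verts
  edge_mem : ∀ u v, G.edge u v → u ∈ G.verts ∧ v ∈ G.verts
  acyclic : ∀ v, ¬ G.Reaches v v
  connected : (G.undirected.induce G.verts).Connected
  locallyFinite : ∀ v ∈ G.verts, {w | G.edge v w ∨ G.edge w v}.Finite

/-- Hop distance from the root, `⊤` for vertices not connected to the root. -/
noncomputable def depth (G : MarkedDigraph) (v : ℕ) : ℕ∞ :=
  G.undirected.edist 0 v

/-- Vertex set of the ball of radius `s` around the root. -/
def ball (G : MarkedDigraph) (s : ℕ) : Set ℕ :=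
  {v | v ∈ G.verts ∧ G.depth v ≤ s}

/-- The balls of radius `s` around the roots of `G` and `H` agree: they have the same vertices
(with their marks) and the same directed edges. -/
def BallsAgree (G H : MarkedDigraph) (s : ℕ) : Prop :=
  G.ball s = H.ball s ∧ ∀ u ∈ G.ball s, ∀ v ∈ G.ball s, (G.edge u v ↔ H.edge u v)

/-- The local metric `1 / (1 + s)`, where `s` is the supremum of the radii at which the balls
around the roots agree; it is `0` if they agree at all radii. -/
noncomputable def dStar (G H : MarkedDigraph) : ℝ≥0∞ :=
  (1 + ⨆ (s : ℕ) (_ : BallsAgree G H s), (s : ℝ≥0∞))⁻¹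

/-- A rooted tree: the underlying undirected graph is a tree, and its edges are directed
towards the root. -/
def IsRootedTree (G : MarkedDigraph) : Prop :=
  0 ∈ G.verts ∧ (G.undirected.induce G.verts).IsTree ∧ ∀ v ∈ G.verts, v ≠ 0 → G.Reaches v 0

/-- A ray: a semi-infinite directed path, oriented either away from or towards its initial vertex.
In an acyclic graph its vertices are automatically distinct. -/
def IsRay (G : MarkedDigraph) (p : ℕ → ℕ) : Prop :=
  (∀ n, G.edge (p n) (p (n + 1))) ∨ (∀ n, G.edge (p (n + 1)) (p n))

/-- Two rays are equivalent if some ray meets both of them in infinitely many vertices. -/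
def RayEquiv (G : MarkedDigraph) (p₁ p₂ : ℕ → ℕ) : Prop :=
  ∃ p₃, G.IsRay p₃ ∧ (Set.range p₁ ∩ Set.range p₃).Infinite ∧
    (Set.range p₂ ∩ Set.range p₃).Infinite

/-- There is exactly one class of rays. -/
def OneEnded (G : MarkedDigraph) : Prop :=
  (∃ p, G.IsRay p) ∧ ∀ p₁ p₂, G.IsRay p₁ → G.IsRay p₂ → G.RayEquiv p₁ p₂

/-- `v` is confirmed if all but finitely many later vertices have a directed path to `v`. -/
def Confirmed (G : MarkedDigraph) (v : ℕ) : Prop :=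
  v ∈ G.verts ∧ {w | w ∈ G.verts ∧ v < w ∧ ¬ G.Reaches w v}.Finite

/-- The graph with the single vertex `0` and no edges. -/
def single : MarkedDigraph where
  verts := {0}
  edge _ _ := False

/-- Add the vertex `t` and the edges from `t` to all elements of `S`. -/
def attach (G : MarkedDigraph) (t : ℕ) (S : Set ℕ) : MarkedDigraph where
  verts := insert t G.verts
  edge u v := G.edge u v ∨ (u = t ∧ v ∈ S)

/-- The vertices at maximal hop distance from the root. -/
def farthest (G : MarkedDigraph) : Set ℕ :=
  {v | v ∈ G.verts ∧ ∀ w ∈ G.verts, G.depth w ≤ G.depth v}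

/-- The Nakamoto construction function: with `m` the number of farthest vertices, it selects the
one of index `⌊u m⌋` (from `0`, in increasing order of marks), which is a uniform choice if `u` is
uniform on `[0, 1]`.  The minimum only matters for `u = 1`. -/
noncomputable def nakamoto (G : MarkedDigraph) (u : ℝ) : Set ℕ :=
  {Nat.nth (· ∈ G.farthest) (min ⌊u * (G.farthest.ncard : ℝ)⌋₊ (G.farthest.ncard - 1))}

/-- The asynchronous composition model with construction function `f`, delays `ξ 1, ξ 2, …` and
edge randomness `θ 1, θ 2, …`, started from the single vertex `0`: the vertex `t` connects to
`f (G_{(t - ξ_t)₊}, θ_t)`.  The truncated subtraction is the positive part, and the minimum is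
inactive for delays that are at least `1`. -/
def acm (f : MarkedDigraph → ℝ → Set ℕ) (ξ : ℕ → ℕ) (θ : ℕ → ℝ) : ℕ → MarkedDigraph
  | 0 => single
  | t + 1 =>
      (acm f ξ θ t).attach (t + 1) (f (acm f ξ θ (min t (t + 1 - ξ (t + 1)))) (θ (t + 1)))
  termination_by t => t
  decreasing_by all_goals omega

end MarkedDigraph

/-- The interval `[t, t + r)` is a regeneration interval of the delay sequence `ξ`. -/
def IsRegenerationInterval (ξ : ℕ → ℕ) (r t : ℕ) : Prop :=
  (∀ s < r, ξ (t + s) = r) ∧ ∀ s, r ≤ s → ξ (t + s) ≤ s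

/-- The smallest value that the delay `X` takes with positive probability. -/
noncomputable def minDelay {Ω : Type*} [MeasurableSpace Ω] (P : MeasureTheory.Measure Ω)
    (X : Ω → ℕ) : ℕ :=
  sInf {n | 0 < P {ω | X ω = n}}

/-! The graph is given by a parent map that lowers marks, so everything reduces to levels (numbers
of steps to `0`). Under the Nakamoto rule a new vertex has level one more than the highest level it
sees.

At a renewal time `t`, the delays on `[t, t + 3r)` all equal `r` and the edge randomness there is
below `1/(3r)`; each later vertex `t + s` has delay at most `s - 2r`. Let `D` be the level of `t + r
- 1`, which sees exactly `G_{t-1}`; so `D` exceeds all levels before `t`. The vertex `t + 2r - 1`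
sees `t + r - 1`, hence lies above level `D`, and all vertices from `t + 3r` on see it, hence lie
above level `D + 1`. Thus levels `D` and `D + 1` are confined to the run, where the small randomness
selects the oldest vertex `a` of level `D`. All of level `D + 1` has parent `a`, and everything
above level `D` descends from `a` (`exists_ancestor`). Infinitely many renewal times force levels to
infinity, so balls stabilise, and give one end and infinitely many confirmed vertices. Each also
starts two adjacent regeneration intervals.

The renewal pattern constrains independent pairs, with failure probabilities eventually `P(ξ > s -
2r)`, summable since `ξ` has finite mean. Its probability is thus bounded below uniformly in `t`,
and Kolmogorov's zero-one law makes it recur (`ae_frequently_pattern`). -/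

namespace MarkedDigraph

/-! ### Trees given by a decreasing parent map -/

/-- The graph on `S` in which every vertex `u ≠ 0` has exactly one outgoing edge, to `par u`. -/
def parentGraph (par : ℕ → ℕ) (S : Set ℕ) : MarkedDigraph where
  verts := S
  edge u v := u ∈ S ∧ u ≠ 0 ∧ v = par u

/-- The number of steps from a vertex to the root along the parent map `par`. -/
def level (par : ℕ → ℕ) (n : ℕ) : ℕ :=
  if h : n ≠ 0 ∧ par n < n then level par (par n) + 1 else 0
  termination_by n
  decreasing_by exact h.2

section Parent

variable {par : ℕ → ℕ} {S : Set ℕ}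

@[simp]
theorem level_zero : level par 0 = 0 := by
  rw [level]; simp

theorem level_eq (hp : ∀ u, u ≠ 0 → par u < u) {u : ℕ} (hu : u ≠ 0) :
    level par u = level par (par u) + 1 := by
  rw [level, dif_pos ⟨hu, hp u hu⟩]

theorem ne_zero_of_level_pos {u : ℕ} (hu : 0 < level par u) : u ≠ 0 := by
  rintro rfl; simp at hu

theorem level_iterate (hp : ∀ u, u ≠ 0 → par u < u) {j u : ℕ} (hj : j ≤ level par u) :
    level par (par^[j] u) = level par u - j := by
  induction j with
  | zero => simp
  | succ j ih =>
    rw [Function.iterate_succ_apply']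
    have h1 := ih (by omega)
    have h2 := level_eq hp (ne_zero_of_level_pos (par := par) (u := par^[j] u) (by omega))
    omega

theorem parentGraph_adj_cases {u v : ℕ} (h : (parentGraph par S).undirected.Adj u v) :
    (u ≠ 0 ∧ v = par u) ∨ (v ≠ 0 ∧ u = par v) := by
  rw [undirected, SimpleGraph.fromRel_adj] at h
  rcases h with ⟨-, ⟨-, h⟩ | ⟨-, h⟩⟩
  · exact Or.inl h
  · exact Or.inr h

theorem parentGraph_adj_par (hp : ∀ u, u ≠ 0 → par u < u) {u : ℕ} (hu : u ∈ S) (h0 : u ≠ 0) :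
    (parentGraph par S).undirected.Adj (par u) u := by
  rw [undirected, SimpleGraph.fromRel_adj]
  exact ⟨(hp u h0).ne, Or.inr ⟨hu, h0, rfl⟩⟩

theorem exists_walk_level (hp : ∀ u, u ≠ 0 → par u < u) (hS : ∀ u ∈ S, u ≠ 0 → par u ∈ S)
    (v : ℕ) (hv : v ∈ S) :
    ∃ w : (parentGraph par S).undirected.Walk 0 v, w.length = level par v := by
  induction v using Nat.strong_induction_on with
  | _ v ih =>
    by_cases h0 : v = 0
    · subst h0
      exact ⟨.nil, by simp⟩
    · obtain ⟨w, hw⟩ := ih (par v) (hp v h0) (hS v hv h0)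
      exact ⟨w.concat (parentGraph_adj_par hp hv h0), by
        rw [SimpleGraph.Walk.length_concat, hw, level_eq hp h0]⟩

/-- Each undirected edge joins a vertex to its parent, so one step changes the level by exactly one.
This is the lower bound for the hop distance in `parentGraph_depth`. -/
theorem level_le_length (hp : ∀ u, u ≠ 0 → par u < u) {u v : ℕ}
    (w : (parentGraph par S).undirected.Walk u v) :
    level par v ≤ level par u + w.length := by
  induction w with
  | nil => simp
  | cons h w ih =>
    rw [SimpleGraph.Walk.length_cons]
    rcases parentGraph_adj_cases h with ⟨h0, h⟩ | ⟨h0, h⟩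
    · have := level_eq hp h0
      rw [← h] at this
      omega
    · have := level_eq hp h0
      rw [← h] at this
      omega

theorem parentGraph_depth (hp : ∀ u, u ≠ 0 → par u < u) (hS : ∀ u ∈ S, u ≠ 0 → par u ∈ S)
    {v : ℕ} (hv : v ∈ S) : (parentGraph par S).depth v = level par v := by
  obtain ⟨w, hw⟩ := exists_walk_level hp hS v hv
  refine le_antisymm ?_ ?_
  · rw [← hw]
    exact SimpleGraph.Walk.edist_le w
  · rw [depth, SimpleGraph.edist_eq_sInf]
    refine le_sInf ?_
    rintro _ ⟨w, rfl⟩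
    have := level_le_length hp w
    simp only [level_zero, zero_add] at this
    exact Nat.cast_le.2 this

theorem parentGraph_ball (hp : ∀ u, u ≠ 0 → par u < u) (hS : ∀ u ∈ S, u ≠ 0 → par u ∈ S)
    (s : ℕ) : (parentGraph par S).ball s = {v | v ∈ S ∧ level par v ≤ s} := by
  ext v
  refine and_congr_right fun hv => ?_
  rw [parentGraph_depth hp hS hv]
  exact_mod_cast Iff.rfl

/-- Both cycle neighbours of the largest vertex on a cycle are smaller than it, so both would be its
parent. -/
theorem parentGraph_isAcyclic (hp : ∀ u, u ≠ 0 → par u < u) :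
    (parentGraph par S).undirected.IsAcyclic := by
  intro v c hc
  obtain ⟨m, hm, hmax⟩ := c.support.toFinset.exists_max_image id ⟨v, by simp⟩
  simp only [List.mem_toFinset, id] at hm hmax
  have hc' : (c.rotate m hm).IsCycle := by simpa using hc
  have hle : ∀ x ∈ (c.rotate m hm).support, x ≤ m := fun x hx =>
    hmax x ((c.mem_support_rotate_iff m hm).1 hx)
  have key : ∀ x ∈ (c.rotate m hm).support,
      (parentGraph par S).undirected.Adj m x → x = par m := by
    intro x hx hadj
    rcases parentGraph_adj_cases hadj with h | ⟨h0, h⟩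
    · exact h.2
    · have := hp x h0
      have := hle x hx
      omega
  refine hc'.snd_ne_penultimate ?_
  exact (key _ (SimpleGraph.Walk.getVert_mem_support _ _)
    (SimpleGraph.Walk.adj_snd hc'.not_nil)).trans
      (key _ (SimpleGraph.Walk.getVert_mem_support _ _)
        (SimpleGraph.Walk.adj_penultimate hc'.not_nil).symm).symm

theorem parentGraph_univ_connected (hp : ∀ u, u ≠ 0 → par u < u) :
    ((parentGraph par Set.univ).undirected.induce (parentGraph par Set.univ).verts).Connected := by
  refine (SimpleGraph.induceUnivIso (parentGraph par Set.univ).undirected).connected_iff.2 ?_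
  have h : ∀ v, (parentGraph par Set.univ).undirected.Reachable 0 v := fun v =>
    (exists_walk_level (S := Set.univ) hp (fun _ _ _ => trivial) v trivial).choose.reachable
  exact ⟨fun u v => (h u).symm.trans (h v)⟩

theorem lt_of_reaches (hp : ∀ u, u ≠ 0 → par u < u) {u v : ℕ}
    (h : (parentGraph par S).Reaches u v) : v < u := by
  induction h with
  | single h => exact h.2.2 ▸ hp _ h.2.1
  | tail _ h ih => exact (h.2.2 ▸ hp _ h.2.1).trans ih

theorem reaches_iterate (hp : ∀ u, u ≠ 0 → par u < u) {u j : ℕ} (hj : j < level par u) :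
    (parentGraph par Set.univ).Reaches u (par^[j + 1] u) := by
  induction j with
  | zero => exact .single ⟨trivial, ne_zero_of_level_pos hj, rfl⟩
  | succ j ih =>
    refine (ih (by omega)).tail ⟨trivial, ?_, Function.iterate_succ_apply' par (j + 1) u⟩
    apply ne_zero_of_level_pos (par := par)
    rw [level_iterate hp (by omega)]
    omega

theorem eq_zero_of_level_eq_zero (hp : ∀ u, u ≠ 0 → par u < u) {u : ℕ} (h : level par u = 0) :
    u = 0 := by
  by_contra h0
  rw [level_eq hp h0] at h
  omega

theorem parentGraph_isRootedTree (hp : ∀ u, u ≠ 0 → par u < u) :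
    (parentGraph par Set.univ).IsRootedTree := by
  refine ⟨trivial, ⟨parentGraph_univ_connected hp, (parentGraph_isAcyclic hp).induce _⟩,
    fun v _ hv => ?_⟩
  have hl := level_eq hp hv
  have h := reaches_iterate hp (u := v) (j := level par v - 1) (by omega)
  rwa [show level par v - 1 + 1 = level par v by omega,
    eq_zero_of_level_eq_zero hp (u := par^[level par v] v)
      (by rw [level_iterate hp le_rfl]; omega)] at h

theorem finite_level_le (hlim : Filter.Tendsto (level par) Filter.atTop Filter.atTop) (k : ℕ) :
    {v | level par v ≤ k}.Finite := by
  obtain ⟨N, hN⟩ := Filter.eventually_atTop.1 (hlim.eventually_gt_atTop k)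
  refine (Set.finite_Iio N).subset fun v hv => ?_
  by_contra h
  exact absurd (hN v (not_lt.1 h)) (not_lt.2 hv)

theorem parentGraph_isBlockDAG (hp : ∀ u, u ≠ 0 → par u < u)
    (hlim : Filter.Tendsto (level par) Filter.atTop Filter.atTop) :
    (parentGraph par Set.univ).IsBlockDAG where
  root_mem := trivial
  edge_mem _ _ _ := ⟨trivial, trivial⟩
  acyclic _ h := (lt_of_reaches hp h).false
  connected := parentGraph_univ_connected hp
  locallyFinite v _ := by
    refine (finite_level_le hlim (level par v + 1)).subset ?_
    rintro w (⟨-, h0, rfl⟩ | ⟨-, h0, rfl⟩)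
    · have := level_eq hp h0
      simp only [Set.mem_ofPred_eq]
      omega
    · exact (level_eq hp h0).le

/-- Since levels tend to infinity, a ball of fixed radius is finite and no longer changes once its
largest mark is present. -/
theorem parentGraph_tendsto_dStar (hp : ∀ u, u ≠ 0 → par u < u)
    (hlim : Filter.Tendsto (level par) Filter.atTop Filter.atTop) :
    Filter.Tendsto
      (fun t : ℕ => dStar (parentGraph par (Set.Iic t)) (parentGraph par Set.univ))
      Filter.atTop (nhds 0) := by
  have hagree : ∀ s : ℕ, ∀ᶠ t : ℕ in Filter.atTop,
      BallsAgree (parentGraph par (Set.Iic t)) (parentGraph par Set.univ) s := by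
    intro s
    obtain ⟨N, hN⟩ := (finite_level_le hlim s).bddAbove
    filter_upwards [Filter.eventually_ge_atTop N] with t ht
    refine ⟨?_, ?_⟩
    · rw [parentGraph_ball (S := Set.Iic t) hp (fun u hu h0 => (hp u h0).le.trans hu),
        parentGraph_ball (S := Set.univ) hp (fun _ _ _ => trivial)]
      ext v
      exact ⟨fun h => ⟨trivial, h.2⟩, fun h => ⟨(hN h.2).trans ht, h.2⟩⟩
    · rintro u ⟨hu, -⟩ v -
      exact ⟨fun h => ⟨trivial, h.2⟩, fun h => ⟨hu, h.2⟩⟩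
  rw [ENNReal.tendsto_nhds_zero]
  intro ε hε
  obtain ⟨n, hn⟩ := ENNReal.exists_inv_nat_lt hε.ne'
  filter_upwards [hagree n] with t ht
  refine le_trans ?_ hn.le
  rw [dStar, ENNReal.inv_le_inv]
  exact (le_iSup₂ (f := fun (s : ℕ) (_ : BallsAgree (parentGraph par (Set.Iic t))
    (parentGraph par Set.univ) s) => (s : ℝ≥0∞)) n ht).trans le_add_self

/-- If the ancestors of the late vertices are eventually constant at each level, there is exactly
one end. -/
theorem parentGraph_oneEnded (hp : ∀ u, u ≠ 0 → par u < u)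
    (hlim : Filter.Tendsto (level par) Filter.atTop Filter.atTop)
    (hanc : ∀ k, ∃ c, ∀ᶠ w in Filter.atTop, par^[level par w - k] w = c) :
    (parentGraph par Set.univ).OneEnded := by
  choose p hpk using hanc
  have hlev : ∀ k, level par (p k) = k := by
    intro k
    obtain ⟨w, h1, h2⟩ := ((hpk k).and (hlim.eventually_ge_atTop k)).exists
    rw [← h1, level_iterate hp (by omega)]
    omega
  have hpar : ∀ k, par (p (k + 1)) = p k := by
    intro k
    obtain ⟨w, h1, h2, h3⟩ :=
      ((hpk k).and ((hpk (k + 1)).and (hlim.eventually_ge_atTop (k + 1)))).exists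
    rw [← h1, ← h2, ← Function.iterate_succ_apply' par]
    congr 1
    omega
  have hray : (parentGraph par Set.univ).IsRay p :=
    Or.inr fun n => ⟨trivial, ne_zero_of_level_pos (par := par) (by rw [hlev]; omega),
      (hpar n).symm⟩
  have hinter : ∀ q, (parentGraph par Set.univ).IsRay q →
      (Set.range q ∩ Set.range p).Infinite := by
    rintro q (hq | hq)
    -- A ray directed towards the root would be an infinite descent in `ℕ`.
    · have hlt : ∀ n, q (n + 1) < q n := fun n => (hq n).2.2 ▸ hp _ (hq n).2.1
      have : ∀ n, q n + n ≤ q 0 := by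
        intro n
        induction n with
        | zero => simp
        | succ n ih => have := hlt n; omega
      have := this (q 0 + 1)
      omega
    · have hmono : StrictMono q := strictMono_nat_of_lt_succ fun n => by
        conv_lhs => rw [(hq n).2.2]
        exact hp _ (hq n).2.1
      have hl : ∀ n, level par (q n) = level par (q 0) + n := by
        intro n
        induction n with
        | zero => simp
        | succ n ih => rw [level_eq hp (hq n).2.1, ← (hq n).2.2, ih]; omega
      have hit : ∀ j n, par^[j] (q (n + j)) = q n := by
        intro j
        induction j with
        | zero => simp
        | succ j ih =>
          intro n
          rw [Function.iterate_succ_apply, ← add_assoc, ← (hq _).2.2, ih]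
      -- A ray away from the root is a tail of `p`: its late vertices have both `q m` and the common
      -- ancestor `p` as their ancestor at that level.
      have hsub : ∀ m, q m = p (level par (q 0) + m) := by
        intro m
        obtain ⟨n, h1, h2⟩ := ((hmono.tendsto_atTop.eventually
          (hpk (level par (q 0) + m))).and (Filter.eventually_ge_atTop m)).exists
        rw [← h1, hl n, Nat.add_sub_add_left]
        conv_rhs => rw [show n = m + (n - m) by omega]
        rw [Nat.add_sub_cancel_left, hit]
      rw [Set.inter_eq_left.2 (by rintro _ ⟨m, rfl⟩; exact ⟨_, (hsub m).symm⟩)]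
      exact Set.infinite_range_of_injective hmono.injective
  exact ⟨⟨p, hray⟩, fun p₁ p₂ h₁ h₂ => ⟨p, hray, hinter p₁ h₁, hinter p₂ h₂⟩⟩

theorem parentGraph_confirmed (hp : ∀ u, u ≠ 0 → par u < u)
    (hlim : Filter.Tendsto (level par) Filter.atTop Filter.atTop) {k a : ℕ}
    (ha : ∀ᶠ w in Filter.atTop, par^[level par w - k] w = a) :
    (parentGraph par Set.univ).Confirmed a := by
  obtain ⟨N, hN⟩ := Filter.eventually_atTop.1 (ha.and (hlim.eventually_gt_atTop k))
  refine ⟨trivial, (Set.finite_Iio N).subset ?_⟩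
  rintro w ⟨-, -, hw⟩
  by_contra h
  obtain ⟨h1, h2⟩ := hN w (not_lt.1 h)
  have := reaches_iterate hp (u := w) (j := level par w - k - 1) (by omega)
  rw [show level par w - k - 1 + 1 = level par w - k by omega, h1] at this
  exact hw this

/-- A common ancestor at level `m` determines those at all lower levels, so unboundedly many levels
suffice for `parentGraph_oneEnded`. -/
theorem eventually_ancestor_of_le {k m a : ℕ} (hkm : k ≤ m)
    (hlim : Filter.Tendsto (level par) Filter.atTop Filter.atTop)
    (ha : ∀ᶠ w in Filter.atTop, par^[level par w - m] w = a) :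
    ∀ᶠ w in Filter.atTop, par^[level par w - k] w = par^[m - k] a := by
  filter_upwards [ha, hlim.eventually_ge_atTop m] with w hw hm
  rw [← hw, ← Function.iterate_add_apply]
  congr 1
  omega

end Parent

end MarkedDigraph

/-! ### The Nakamoto model as a parent map -/

namespace MarkedDigraph

/-- The element of the set of farthest vertices selected by `nakamoto`. -/
noncomputable def nakamotoVertex (G : MarkedDigraph) (u : ℝ) : ℕ :=
  Nat.nth (· ∈ G.farthest) (min ⌊u * (G.farthest.ncard : ℝ)⌋₊ (G.farthest.ncard - 1))

theorem nakamoto_eq (G : MarkedDigraph) (u : ℝ) : G.nakamoto u = {G.nakamotoVertex u} := rfl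

theorem nakamotoVertex_mem {G : MarkedDigraph} (hfin : G.verts.Finite) (hne : G.verts.Nonempty)
    (u : ℝ) : G.nakamotoVertex u ∈ G.farthest := by
  have hf : G.farthest.Finite := hfin.subset fun v hv => hv.1
  obtain ⟨a, ha, hmax⟩ := hfin.exists_maximalFor G.depth _ hne
  have hpos : 0 < G.farthest.ncard := (Set.ncard_pos hf).2
    ⟨a, ha, fun w hw => (le_total (G.depth w) (G.depth a)).elim id fun h => hmax hw h⟩
  refine Nat.nth_mem_of_lt_card (p := (· ∈ G.farthest)) hf ?_
  have h := Set.ncard_eq_toFinset_card _ hf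
  change _ < hf.toFinset.card
  omega

theorem nakamotoVertex_le {G : MarkedDigraph} {u : ℝ} (hu : u * G.farthest.ncard < 1)
    {v : ℕ} (hv : v ∈ G.farthest) : G.nakamotoVertex u ≤ v := by
  rw [nakamotoVertex, Nat.floor_eq_zero.2 hu, Nat.zero_min, Nat.nth_zero]
  exact Nat.sInf_le hv

/-- The time of the graph seen by the vertex `u`. -/
def view (ξ : ℕ → ℕ) (u : ℕ) : ℕ := min (u - 1) (u - ξ u)

/-- The parent of a vertex in the asynchronous composition model with the Nakamoto construction
function. -/
noncomputable def nakamotoParent (ξ : ℕ → ℕ) (θ : ℕ → ℝ) (u : ℕ) : ℕ :=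
  (acm nakamoto ξ θ (view ξ u)).nakamotoVertex (θ u)

variable {ξ : ℕ → ℕ} {θ : ℕ → ℝ}

/-- All the `G_t` are restrictions of one parent map. Hence the depth of a vertex never changes, and
a single level function serves all times. -/
theorem acm_eq_parentGraph (t : ℕ) :
    acm nakamoto ξ θ t = parentGraph (nakamotoParent ξ θ) (Set.Iic t) := by
  induction t with
  | zero =>
    rw [acm]
    ext u v
    · simp [single, parentGraph]
    · simp +contextual [single, parentGraph]
  | succ t ih =>
    rw [acm, ih, nakamoto_eq]
    ext u v
    · simp only [attach, parentGraph, Set.mem_insert_iff, Set.mem_Iic]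
      omega
    · simp only [attach, parentGraph, Set.mem_Iic, Set.mem_singleton_iff]
      constructor
      · rintro (⟨h, h0, rfl⟩ | ⟨rfl, rfl⟩)
        · exact ⟨by omega, h0, rfl⟩
        · exact ⟨le_rfl, by omega, rfl⟩
      · rintro ⟨h, h0, rfl⟩
        rcases Nat.lt_or_ge t u with h' | h'
        · obtain rfl : u = t + 1 := by omega
          exact Or.inr ⟨rfl, rfl⟩
        · exact Or.inl ⟨h', h0, rfl⟩

theorem nakamotoParent_mem_farthest (u : ℕ) :
    nakamotoParent ξ θ u ∈ (acm nakamoto ξ θ (view ξ u)).farthest := by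
  refine nakamotoVertex_mem ?_ ?_ _
  · rw [acm_eq_parentGraph]
    exact Set.finite_Iic _
  · rw [acm_eq_parentGraph]
    exact ⟨0, Nat.zero_le _⟩

theorem nakamotoParent_le_view (u : ℕ) : nakamotoParent ξ θ u ≤ view ξ u := by
  have h := (nakamotoParent_mem_farthest (ξ := ξ) (θ := θ) u).1
  rwa [acm_eq_parentGraph] at h

theorem nakamotoParent_lt (u : ℕ) (hu : u ≠ 0) : nakamotoParent ξ θ u < u :=
  (nakamotoParent_le_view u).trans_lt ((min_le_left _ _).trans_lt (by omega))

theorem acm_depth {t v : ℕ} (hv : v ≤ t) :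
    (acm nakamoto ξ θ t).depth v = level (nakamotoParent ξ θ) v := by
  rw [acm_eq_parentGraph, parentGraph_depth (S := Set.Iic t) nakamotoParent_lt
    (fun u hu h0 => (nakamotoParent_lt u h0).le.trans hu) hv]

theorem mem_farthest_acm {t v : ℕ} : v ∈ (acm nakamoto ξ θ t).farthest ↔
    v ≤ t ∧ ∀ w ≤ t, level (nakamotoParent ξ θ) w ≤ level (nakamotoParent ξ θ) v := by
  have hverts : (acm nakamoto ξ θ t).verts = Set.Iic t := by rw [acm_eq_parentGraph]; rfl
  simp only [farthest, hverts, Set.mem_ofPred_eq, Set.mem_Iic]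
  refine and_congr_right fun hv => forall₂_congr fun w hw => ?_
  rw [acm_depth hv, acm_depth hw, Nat.cast_le]

theorem level_le_level_nakamotoParent {u v : ℕ} (hv : v ≤ view ξ u) :
    level (nakamotoParent ξ θ) v ≤ level (nakamotoParent ξ θ) (nakamotoParent ξ θ u) :=
  (mem_farthest_acm.1 (nakamotoParent_mem_farthest u)).2 v hv

/-- A vertex with small edge randomness chooses the oldest among the deepest vertices it sees, if
these lie in a short interval. -/
theorem nakamotoParent_le {u v t M : ℕ} (hθ : θ u * M < 1)
    (hI : ∀ w ≤ view ξ u, level (nakamotoParent ξ θ) w =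
      level (nakamotoParent ξ θ) (nakamotoParent ξ θ u) → t ≤ w ∧ w < t + M)
    (hv : v ≤ view ξ u) (hl : level (nakamotoParent ξ θ) v =
      level (nakamotoParent ξ θ) (nakamotoParent ξ θ u)) :
    nakamotoParent ξ θ u ≤ v := by
  refine nakamotoVertex_le ?_ (mem_farthest_acm.2
    ⟨hv, fun w hw => hl ▸ level_le_level_nakamotoParent hw⟩)
  have hsub : (acm nakamoto ξ θ (view ξ u)).farthest ⊆ Set.Ico t (t + M) := fun w hw => by
    obtain ⟨h1, h2⟩ := mem_farthest_acm.1 hw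
    exact hI w h1 (le_antisymm (level_le_level_nakamotoParent h1)
      (h2 _ (nakamotoParent_le_view u)))
  have hcard : (acm nakamoto ξ θ (view ξ u)).farthest.ncard ≤ M := by
    refine (Set.ncard_le_ncard hsub (Set.finite_Ico _ _)).trans ?_
    rw [← Finset.coe_Ico, Set.ncard_coe_finset, Nat.card_Ico, Nat.add_sub_cancel_left]
  -- No sign of `θ u` is assumed; replacing the cardinality by its bound `M` needs `θ u` positive.
  rcases le_or_gt (θ u) 0 with h0 | h0
  · exact (mul_nonpos_of_nonpos_of_nonneg h0 (Nat.cast_nonneg _)).trans_lt one_pos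
  · exact (mul_le_mul_of_nonneg_left (Nat.cast_le.2 hcard) h0.le).trans_lt hθ

end MarkedDigraph

/-! ### Renewal times and common ancestors -/

/-- The values of the delay and the edge randomness allowed `s` steps after a renewal time. -/
def renewalSet (r s : ℕ) : Set (ℕ × ℝ) :=
  if s < 3 * r then {r} ×ˢ {x : ℝ | x * (3 * r : ℕ) < 1} else Set.Iic (s - 2 * r) ×ˢ Set.univ

/-- `t` is a renewal time: a run of `3 r` delays equal to `r` with small edge randomness starts at
`t`, and all later vertices see at least the first two thirds of this run. -/
def IsRenewalTime (ξ : ℕ → ℕ) (θ : ℕ → ℝ) (r t : ℕ) : Prop :=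
  ∀ s, (ξ (t + s), θ (t + s)) ∈ renewalSet r s

namespace IsRenewalTime

variable {ξ : ℕ → ℕ} {θ : ℕ → ℝ} {r t : ℕ}

theorem delay_eq (h : IsRenewalTime ξ θ r t) {s : ℕ} (hs : s < 3 * r) : ξ (t + s) = r := by
  have := h s
  rw [renewalSet, if_pos hs] at this
  exact this.1

theorem mul_lt_one (h : IsRenewalTime ξ θ r t) {s : ℕ} (hs : s < 3 * r) :
    θ (t + s) * (3 * r : ℕ) < 1 := by
  have := h s
  rw [renewalSet, if_pos hs] at this
  exact this.2

theorem delay_le (h : IsRenewalTime ξ θ r t) {s : ℕ} (hs : 3 * r ≤ s) :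
    ξ (t + s) ≤ s - 2 * r := by
  have := h s
  rw [renewalSet, if_neg (not_lt.2 hs)] at this
  exact this.1

theorem isRegenerationInterval (h : IsRenewalTime ξ θ r t) : IsRegenerationInterval ξ r t := by
  refine ⟨fun s hs => h.delay_eq (by omega), fun s hs => ?_⟩
  rcases lt_or_ge s (3 * r) with h' | h'
  · exact (h.delay_eq h').trans_le hs
  · exact (h.delay_le h').trans (Nat.sub_le _ _)

theorem isRegenerationInterval_add (h : IsRenewalTime ξ θ r t) :
    IsRegenerationInterval ξ r (t + r) := by
  refine ⟨fun s hs => ?_, fun s hs => ?_⟩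
  · rw [add_assoc]
    exact h.delay_eq (by omega)
  · rw [add_assoc]
    rcases lt_or_ge (r + s) (3 * r) with h' | h'
    · exact (h.delay_eq h').trans_le hs
    · exact (h.delay_le h').trans (by omega)

open MarkedDigraph

/-- After a renewal time `t` all vertices that are deep enough descend from the same vertex `a`. -/
theorem exists_ancestor (h : IsRenewalTime ξ θ r t) (hr : 1 ≤ r) (ht : 1 ≤ t) :
    ∃ a D, t ≤ a ∧ level (nakamotoParent ξ θ) (t - 1) < D ∧
      (∀ w, t + 3 * r ≤ w → D + 1 < level (nakamotoParent ξ θ) w) ∧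
      ∀ w, D < level (nakamotoParent ξ θ) w →
        (nakamotoParent ξ θ)^[level (nakamotoParent ξ θ) w - D] w = a := by
  set par := nakamotoParent ξ θ
  have hp : ∀ u, u ≠ 0 → par u < u := nakamotoParent_lt
  have hstep : ∀ u v, u ≠ 0 → v ≤ view ξ u → level par v < level par u := fun u v hu hv => by
    rw [level_eq hp hu]
    exact Nat.lt_succ_of_le (level_le_level_nakamotoParent hv)
  have hview : ∀ s < 3 * r, r ≤ t + s → view ξ (t + s) = t + s - r := fun s hs _ => by
    rw [view, h.delay_eq hs]
    omega
  set b := t + (r - 1) with hb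
  set D := level par b with hD
  have hvb : view ξ b = t - 1 := by
    rw [hb, hview _ (by omega) (by omega)]
    omega
  have hbefore : ∀ v, v < t → level par v < D := fun v hv =>
    hstep b v (by omega) (by rw [hvb]; omega)
  have hvc : view ξ (t + (2 * r - 1)) = b := by
    rw [hview _ (by omega) (by omega)]
    omega
  have hc : D < level par (t + (2 * r - 1)) := hstep _ b (by omega) hvc.ge
  -- Delay at most `w - t - 2r` means that `w` sees time `t + 2r`, hence the vertex `t + 2r - 1`.
  have hlate : ∀ w, t + 3 * r ≤ w → D + 1 < level par w := fun w hw => by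
    refine lt_of_le_of_lt (Nat.succ_le_of_lt hc) (hstep w _ (by omega) ?_)
    have := h.delay_le (s := w - t) (by omega)
    rw [show t + (w - t) = w by omega] at this
    rw [view]
    omega
  have hex : ∃ a, level par a = D := ⟨b, rfl⟩
  classical
  set a := Nat.find hex with ha
  have haD : level par a = D := Nat.find_spec hex
  have hmin : ∀ v, level par v = D → a ≤ v := fun v hv => Nat.find_min' hex hv
  have hta : t ≤ a := by
    by_contra hlt
    exact absurd haD (hbefore a (not_le.1 hlt)).ne
  -- Such a `w` lies in the run and its deepest visible vertices, of level `D`, lie in `[t, t +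
  -- 3r)`. The vertex `a` is visible to `w` because it is at most `par w`.
  have hchild : ∀ w, level par w = D + 1 → par w = a := by
    intro w hw
    have hw0 : w ≠ 0 := ne_zero_of_level_pos (par := par) (by omega)
    have hpw : level par (par w) = D := by
      have := level_eq hp hw0
      omega
    have hwt : t ≤ w := by
      by_contra hlt
      have := hbefore w (not_le.1 hlt)
      omega
    have hwt' : w < t + 3 * r := by
      by_contra hge
      have := hlate w (not_lt.1 hge)
      omega
    refine le_antisymm ?_ (hmin _ hpw)
    have hθ := h.mul_lt_one (s := w - t) (by omega)
    rw [show t + (w - t) = w by omega] at hθ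
    refine nakamotoParent_le hθ (t := t) (fun v hv hl => ⟨?_, ?_⟩)
      ((hmin _ hpw).trans (nakamotoParent_le_view w)) (haD.trans hpw.symm)
    · by_contra hlt
      exact absurd (hl.trans hpw) (hbefore v (not_le.1 hlt)).ne
    · have : view ξ w ≤ w - 1 := min_le_left _ _
      omega
  refine ⟨a, D, hta, hbefore _ (by omega), hlate, fun w => ?_⟩
  induction w using Nat.strong_induction_on with
  | _ w ih =>
    intro hw
    have hw0 : w ≠ 0 := ne_zero_of_level_pos (par := par) (by omega)
    have hl := level_eq hp hw0
    rcases eq_or_lt_of_le (Nat.succ_le_of_lt hw) with h1 | h1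
    · rw [← h1, show D.succ - D = 1 by omega]
      exact hchild w h1.symm
    · have := ih (par w) (hp w hw0) (by omega)
      rwa [← Function.iterate_succ_apply, show (level par (par w) - D).succ = level par w - D by
        omega] at this

end IsRenewalTime

/-! ### Consequences of infinitely many renewal times -/

namespace MarkedDigraph

variable {ξ : ℕ → ℕ} {θ : ℕ → ℝ} {r : ℕ}

theorem tendsto_level_nakamotoParent (hr : 1 ≤ r)
    (hren : ∀ N, ∃ t, N ≤ t ∧ IsRenewalTime ξ θ r t) :
    Filter.Tendsto (level (nakamotoParent ξ θ)) Filter.atTop Filter.atTop := by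
  refine Filter.tendsto_atTop.2 fun k => ?_
  induction k with
  | zero => exact Filter.Eventually.of_forall fun _ => Nat.zero_le _
  | succ k ih =>
    obtain ⟨N, hN⟩ := Filter.eventually_atTop.1 ih
    obtain ⟨t, ht, h⟩ := hren (N + 1)
    obtain ⟨a, D, -, h1, h2, -⟩ := h.exists_ancestor hr (by omega)
    filter_upwards [Filter.eventually_ge_atTop (t + 3 * r)] with w hw
    have := hN (t - 1) (by omega)
    have := h2 w hw
    omega

/-- The limit graph exists and has the stated properties if there are infinitely many renewal
times. -/
theorem exists_limit_of_renewalTimes (hr : 1 ≤ r)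
    (hren : ∀ N, ∃ t, N ≤ t ∧ IsRenewalTime ξ θ r t) :
    ∃ G : MarkedDigraph, G.IsBlockDAG ∧
      Filter.Tendsto (fun t => dStar (acm nakamoto ξ θ t) G) Filter.atTop (nhds 0) ∧
      G.OneEnded ∧ G.IsRootedTree ∧ {v | G.Confirmed v}.Infinite := by
  have hp : ∀ u, u ≠ 0 → nakamotoParent ξ θ u < u := nakamotoParent_lt
  have hlim := tendsto_level_nakamotoParent hr hren
  have hanc : ∀ N, ∃ a D, N ≤ a ∧ level (nakamotoParent ξ θ) N ≤ D ∧
      ∀ᶠ w in Filter.atTop, (nakamotoParent ξ θ)^[level (nakamotoParent ξ θ) w - D] w = a := by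
    intro N
    -- Taking `t - 1` beyond `M` makes `D` exceed the level of `N`; taking it beyond `N` makes `a`
    -- larger than `N`.
    obtain ⟨M, hM⟩ := Filter.eventually_atTop.1
      (hlim.eventually_ge_atTop (level (nakamotoParent ξ θ) N))
    obtain ⟨t, ht, h⟩ := hren (max N M + 1)
    obtain ⟨a, D, h1, h2, h3, h4⟩ := h.exists_ancestor hr (by omega)
    refine ⟨a, D, by omega, (hM (t - 1) (by omega)).trans h2.le, ?_⟩
    filter_upwards [hlim.eventually_gt_atTop D] with w hw using h4 w hw
  refine ⟨parentGraph (nakamotoParent ξ θ) Set.univ, parentGraph_isBlockDAG hp hlim, ?_, ?_,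
    parentGraph_isRootedTree hp, ?_⟩
  · simp only [acm_eq_parentGraph]
    exact parentGraph_tendsto_dStar hp hlim
  · refine parentGraph_oneEnded hp hlim fun k => ?_
    obtain ⟨N, hN⟩ := (hlim.eventually_ge_atTop k).exists
    obtain ⟨a, D, -, h1, h2⟩ := hanc N
    exact ⟨_, eventually_ancestor_of_le (hN.trans h1) hlim h2⟩
  · refine Set.infinite_of_not_bddAbove ?_
    rintro ⟨B, hB⟩
    obtain ⟨a, D, h1, -, h2⟩ := hanc (B + 1)
    have := hB (parentGraph_confirmed hp hlim h2)
    omega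

end MarkedDigraph

/-! ### Almost sure recurrence of renewal times -/

section Probability

open MeasureTheory ProbabilityTheory

/-- Measurable rectangles form a generating π-system, and on them the probability factors first
between the two families and then within each. -/
theorem ProbabilityTheory.iIndepFun.prodMk_of_indepFun {Ω ι β γ : Type*} [MeasurableSpace Ω]
    [MeasurableSpace β] [MeasurableSpace γ] {P : Measure Ω} {X : ι → Ω → β} {Y : ι → Ω → γ}
    (hX_meas : ∀ i, Measurable (X i)) (hY_meas : ∀ i, Measurable (Y i))
    (hX : iIndepFun X P) (hY : iIndepFun Y P)
    (hXY : IndepFun (fun ω i => X i ω) (fun ω i => Y i ω) P) :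
    iIndepFun (fun i ω => (X i ω, Y i ω)) P := by
  rw [iIndepFun_iff_iIndep]
  refine iIndepSets.iIndep (fun i => ((hX_meas i).prodMk (hY_meas i)).comap_le)
    (fun i => {s | ∃ t ∈ Set.image2 (· ×ˢ ·) {s : Set β | MeasurableSet s}
      {t : Set γ | MeasurableSet t}, (fun ω => (X i ω, Y i ω)) ⁻¹' t = s})
    (fun i => isPiSystem_prod.comap _) (fun i => ?_) ?_
  · rw [← generateFrom_prod, MeasurableSpace.comap_generateFrom]
    rfl
  rw [iIndepSets_iff]
  intro S f hf
  have hex : ∀ i, ∃ (A : Set β) (B : Set γ), i ∈ S → MeasurableSet A ∧ MeasurableSet B ∧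
      f i = X i ⁻¹' A ∩ Y i ⁻¹' B := by
    intro i
    by_cases hi : i ∈ S
    · obtain ⟨_, ⟨A, hA, B, hB, rfl⟩, h⟩ := hf i hi
      exact ⟨A, B, fun _ => ⟨hA, hB, h.symm⟩⟩
    · exact ⟨∅, ∅, fun h => absurd h hi⟩
  choose A B hAB using hex
  have hinter : ∀ A' : ι → Set β, ∀ B' : ι → Set γ, (∀ i ∈ S, MeasurableSet (A' i)) →
      (∀ i ∈ S, MeasurableSet (B' i)) → P ((⋂ i ∈ S, X i ⁻¹' A' i) ∩ ⋂ i ∈ S, Y i ⁻¹' B' i) =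
        P (⋂ i ∈ S, X i ⁻¹' A' i) * P (⋂ i ∈ S, Y i ⁻¹' B' i) := by
    intro A' B' hA' hB'
    have h := indepFun_iff_measure_inter_preimage_eq_mul.1 hXY
      (⋂ i ∈ S, (fun x : ι → β => x i) ⁻¹' A' i) (⋂ i ∈ S, (fun x : ι → γ => x i) ⁻¹' B' i)
      (Finset.measurableSet_biInter _ fun i hi => measurable_pi_apply i (hA' i hi))
      (Finset.measurableSet_biInter _ fun i hi => measurable_pi_apply i (hB' i hi))
    simpa only [Set.preimage_iInter, ← Set.preimage_comp, Function.comp_def] using h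
  have hone : ∀ i ∈ S, P (f i) = P (X i ⁻¹' A i) * P (Y i ⁻¹' B i) := by
    intro i hi
    obtain ⟨hA, hB, h⟩ := hAB i hi
    rw [h]
    exact indepFun_iff_measure_inter_preimage_eq_mul.1
      (hXY.comp (measurable_pi_apply i) (measurable_pi_apply i)) _ _ hA hB
  have hall : ⋂ i ∈ S, f i = (⋂ i ∈ S, X i ⁻¹' A i) ∩ ⋂ i ∈ S, Y i ⁻¹' B i := by
    simp only [← Set.iInter_inter_distrib]
    exact Set.iInter₂_congr fun i hi => (hAB i hi).2.2
  rw [hall, hinter A B (fun i hi => (hAB i hi).1) (fun i hi => (hAB i hi).2.1),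
    Finset.prod_congr rfl hone, Finset.prod_mul_distrib,
    iIndepFun_iff_measure_inter_preimage_eq_mul.1 hX S (fun i hi => (hAB i hi).1),
    iIndepFun_iff_measure_inter_preimage_eq_mul.1 hY S (fun i hi => (hAB i hi).2.1)]

/-- Summability of `1 - p s` gives summability of `-log (p s)`; the exponential of minus its sum
bounds all partial products. -/
theorem exists_pos_le_prod_of_summable_one_sub {p : ℕ → ℝ} (h0 : ∀ s, 0 < p s)
    (h1 : ∀ s, p s ≤ 1) (hsum : Summable fun s => 1 - p s) :
    ∃ c, 0 < c ∧ ∀ n, c ≤ ∏ s ∈ Finset.range n, p s := by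
  have hlog : Summable fun s => -Real.log (p s) := by
    have := Real.summable_log_one_add_of_summable hsum.neg
    simpa using this.neg
  refine ⟨Real.exp (-∑' s, -Real.log (p s)), Real.exp_pos _, fun n => ?_⟩
  rw [← Real.exp_log (Finset.prod_pos fun s _ => h0 s), Real.log_prod fun s _ => (h0 s).ne']
  refine Real.exp_le_exp.2 (neg_le.1 ?_)
  rw [← Finset.sum_neg_distrib]
  exact hlog.sum_le_tsum _ fun s _ => neg_nonneg.2 (Real.log_nonpos (h0 s).le (h1 s))

/-- For i.i.d. variables `Z`, the pattern `Z (t + s) ∈ A s` for all `s` almost surely occurs at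
infinitely many times `t` if the sets `A s` have positive and sufficiently large probabilities. -/
theorem ae_frequently_pattern {Ω β : Type*} [MeasurableSpace Ω] [MeasurableSpace β]
    {P : Measure Ω} [IsProbabilityMeasure P] {Z : ℕ → Ω → β} (hZ_meas : ∀ t, Measurable (Z t))
    (hZ : iIndepFun Z P) (hident : ∀ t, IdentDistrib (Z t) (Z 0) P P) {A : ℕ → Set β}
    (hA : ∀ s, MeasurableSet (A s)) (hpos : ∀ s, P (Z 0 ⁻¹' A s) ≠ 0)
    (hsum : Summable fun s => P.real (Z 0 ⁻¹' (A s)ᶜ)) :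
    ∀ᵐ ω ∂P, ∀ N, ∃ t, N ≤ t ∧ ∀ s, Z (t + s) ω ∈ A s := by
  set E : ℕ → Set Ω := fun t => ⋂ s, Z (t + s) ⁻¹' A s with hE
  have hE_meas : ∀ t, MeasurableSet (E t) := fun t =>
    MeasurableSet.iInter fun s => hZ_meas _ (hA s)
  have hE_tail : ∀ n t, n ≤ t →
      MeasurableSet[⨆ i, ⨆ (_ : i ≥ n), MeasurableSpace.comap (Z i) inferInstance] (E t) := by
    intro n t hnt
    refine MeasurableSet.iInter fun s => ?_
    exact (le_iSup₂ (f := fun i (_ : i ≥ n) => MeasurableSpace.comap (Z i) inferInstance) (t + s)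
      (by omega)) _ ⟨A s, hA s, rfl⟩
  -- By identical distribution the bound `c` does not depend on `t`, so it survives in the limsup
  -- event `T`.
  obtain ⟨c, hc, hcle⟩ : ∃ c : ℝ, 0 < c ∧ ∀ t, ENNReal.ofReal c ≤ P (E t) := by
    obtain ⟨c, hc, hcle⟩ := exists_pos_le_prod_of_summable_one_sub
      (p := fun s => P.real (Z 0 ⁻¹' A s)) (fun s => ENNReal.toReal_pos (hpos s) (by finiteness))
      (fun s => measureReal_le_one) (by
        refine hsum.congr fun s => ?_
        rw [Set.preimage_compl, probReal_compl_eq_one_sub (hZ_meas 0 (hA s))])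
    refine ⟨c, hc, fun t => ?_⟩
    have hfin : ∀ n, ENNReal.ofReal c ≤ P (⋂ s ∈ Finset.range n, Z (t + s) ⁻¹' A s) := by
      intro n
      rw [iIndepFun_iff_measure_inter_preimage_eq_mul.1
        (hZ.precomp (g := fun s => t + s) (add_right_injective t)) (Finset.range n)
        (fun s _ => hA s)]
      refine (ENNReal.ofReal_le_ofReal (hcle n)).trans_eq ?_
      rw [ENNReal.ofReal_prod_of_nonneg fun s _ => measureReal_nonneg]
      refine Finset.prod_congr rfl fun s _ => ?_
      rw [ofReal_measureReal, (hident (t + s)).measure_mem_eq (hA s)]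
    have hanti : Antitone fun n => ⋂ s ∈ Finset.range n, Z (t + s) ⁻¹' A s := fun m n hmn =>
      Set.biInter_subset_biInter_left fun s hs =>
        Finset.mem_range.2 ((Finset.mem_range.1 hs).trans_le hmn)
    have hlim := tendsto_measure_iInter_atTop (μ := P) (fun n =>
      (Finset.measurableSet_biInter (Finset.range n)
        fun s _ => hZ_meas (t + s) (hA s)).nullMeasurableSet) hanti ⟨0, by finiteness⟩
    have hEq : ⋂ n, ⋂ s ∈ Finset.range n, Z (t + s) ⁻¹' A s = E t := by
      ext ω
      simp only [Set.mem_iInter, Finset.mem_range, hE]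
      exact ⟨fun h s => h (s + 1) s (by omega), fun h _ s _ => h s⟩
    rw [hEq] at hlim
    exact ge_of_tendsto hlim (Filter.Eventually.of_forall hfin)
  set T : Set Ω := ⋂ n, ⋃ k, E (n + k) with hT
  have hT_mem : ∀ ω, ω ∈ T ↔ ∀ N, ∃ t, N ≤ t ∧ ω ∈ E t := by
    intro ω
    simp only [hT, Set.mem_iInter, Set.mem_iUnion]
    refine forall_congr' fun n => ⟨fun ⟨k, hk⟩ => ⟨n + k, by omega, hk⟩, fun ⟨t, ht, h⟩ =>
      ⟨t - n, by rwa [Nat.add_sub_cancel' ht]⟩⟩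
  have hT_pos : P T ≠ 0 := by
    have hanti : Antitone fun n => ⋃ k, E (n + k) := fun m n hmn => by
      refine Set.iUnion_subset fun k => ?_
      rw [show n + k = m + (n - m + k) by omega]
      exact Set.subset_iUnion (fun k => E (m + k)) _
    have hlim := tendsto_measure_iInter_atTop (μ := P) (fun n =>
      (MeasurableSet.iUnion fun k => hE_meas (n + k)).nullMeasurableSet) hanti ⟨0, by finiteness⟩
    have hge := ge_of_tendsto hlim (Filter.Eventually.of_forall fun n =>
      (hcle (n + 0)).trans (measure_mono (Set.subset_iUnion (fun k => E (n + k)) 0)))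
    exact ((ENNReal.ofReal_pos.2 hc).trans_le hge).ne'
  have hT_tail : MeasurableSet[Filter.limsup
      (fun i => MeasurableSpace.comap (Z i) inferInstance) Filter.atTop] T := by
    rw [Filter.limsup_eq_iInf_iSup_of_nat, MeasurableSpace.measurableSet_iInf]
    intro n
    -- Dropping the first `n` indices leaves `T` unchanged, so it depends only on `Z i` with `i ≥
    -- n`.
    have hTn : T = ⋂ m, ⋃ k, E (n + m + k) := by
      ext ω
      rw [hT_mem]
      simp only [Set.mem_iInter, Set.mem_iUnion]
      constructor
      · intro h m
        obtain ⟨t, ht, hω⟩ := h (n + m)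
        exact ⟨t - (n + m), by rwa [Nat.add_sub_cancel' ht]⟩
      · intro h N
        obtain ⟨k, hk⟩ := h N
        exact ⟨_, by omega, hk⟩
    rw [hTn]
    exact MeasurableSet.iInter fun m => MeasurableSet.iUnion fun k => hE_tail n _ (by omega)
  have hT_one : P T = 1 := (measure_zero_or_one_of_measurableSet_limsup_atTop
    (fun n => (hZ_meas n).comap_le) hZ.iIndep hT_tail).resolve_left hT_pos
  have hae : ∀ᵐ ω ∂P, ω ∈ T := (prob_compl_eq_zero_iff
    (MeasurableSet.iInter fun n => MeasurableSet.iUnion fun k => hE_meas _)).2 hT_one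
  filter_upwards [hae] with ω hω N
  obtain ⟨t, ht, h⟩ := (hT_mem ω).1 hω N
  exact ⟨t, ht, fun s => Set.mem_iInter.1 h s⟩

theorem integrable_natCast_of_rpow {Ω : Type*} [MeasurableSpace Ω] {P : Measure Ω} {X : Ω → ℕ}
    (hX : Measurable X) {q : ℝ} (hq : 1 ≤ q)
    (h : Integrable (fun ω => (X ω : ℝ) ^ q) P) : Integrable (fun ω => (X ω : ℝ)) P := by
  refine h.mono (measurable_from_nat.comp hX).aestronglyMeasurable
    (Filter.Eventually.of_forall fun ω => ?_)
  rw [Real.norm_of_nonneg (Nat.cast_nonneg _),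
    Real.norm_of_nonneg (Real.rpow_nonneg (Nat.cast_nonneg _) _)]
  -- A natural number is `0` or at least `1`, so `x ≤ x ^ q` always holds.
  rcases Nat.eq_zero_or_pos (X ω) with h0 | h0
  · rw [h0, Nat.cast_zero, Real.zero_rpow (by linarith)]
  · exact Real.self_le_rpow_of_one_le (Nat.one_le_cast.2 h0) hq

theorem summable_measureReal_lt {Ω : Type*} [MeasurableSpace Ω] {P : Measure Ω}
    [IsProbabilityMeasure P] {X : Ω → ℕ} (hint : Integrable (fun ω => (X ω : ℝ)) P) :
    Summable fun k : ℕ => P.real {ω | k < X ω} := by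
  let _ : MeasureSpace Ω := ⟨P⟩
  have h := tsum_prob_mem_Ioi_lt_top (X := fun ω => (X ω : ℝ)) hint fun ω => Nat.cast_nonneg _
  refine (ENNReal.summable_toReal h.ne).congr fun k => ?_
  simp only [Set.mem_Ioi, Nat.cast_lt]
  rfl

theorem measurableSet_renewalSet (r s : ℕ) : MeasurableSet (renewalSet r s) := by
  unfold renewalSet
  split_ifs
  · exact (measurableSet_singleton r).prod
      (measurableSet_lt (measurable_id.mul_const _) measurable_const)
  · exact measurableSet_Iic.prod MeasurableSet.univ

/-- Some value of `X` has positive probability, as countably many null events cannot cover `Ω`; so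
the infimum is attained. -/
theorem measure_minDelay_pos {Ω : Type*} [MeasurableSpace Ω] {P : Measure Ω}
    [IsProbabilityMeasure P] (X : Ω → ℕ) : 0 < P {ω | X ω = minDelay P X} := by
  refine Nat.sInf_mem (s := {n | 0 < P {ω | X ω = n}}) ?_
  by_contra h
  have h0 : ∀ n, P {ω | X ω = n} = 0 := fun n =>
    nonpos_iff_eq_zero.1 (not_lt.1 fun hn => h ⟨n, hn⟩)
  have : P (⋃ n, {ω | X ω = n}) = 0 := measure_iUnion_null h0
  rw [show (⋃ n, {ω | X ω = n}) = Set.univ from Set.eq_univ_of_forall fun ω =>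
    Set.mem_iUnion.2 ⟨X ω, rfl⟩, measure_univ] at this
  exact one_ne_zero this

theorem one_le_minDelay {Ω : Type*} [MeasurableSpace Ω] {P : Measure Ω}
    [IsProbabilityMeasure P] {X : Ω → ℕ} (hX : ∀ᵐ ω ∂P, 1 ≤ X ω) : 1 ≤ minDelay P X := by
  by_contra h
  have hpos := measure_minDelay_pos (P := P) X
  rw [show minDelay P X = 0 by omega] at hpos
  refine hpos.ne' (measure_mono_null (fun ω hω => ?_) (ae_iff.1 hX))
  simp only [Set.mem_ofPred_eq] at hω ⊢
  omega

theorem ae_frequently_isRenewalTime {Ω : Type*} [MeasurableSpace Ω]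
    {P : Measure Ω} [IsProbabilityMeasure P] {ξ : ℕ → Ω → ℕ} {θ : ℕ → Ω → ℝ}
    (hξ_meas : ∀ t, Measurable (ξ (t + 1))) (hθ_meas : ∀ t, Measurable (θ (t + 1)))
    (hξ_indep : iIndepFun (fun t => ξ (t + 1)) P)
    (hξ_ident : ∀ t, IdentDistrib (ξ (t + 1)) (ξ 1) P P)
    (hθ_indep : iIndepFun (fun t => θ (t + 1)) P)
    (hθ_unif : ∀ t, P.map (θ (t + 1)) = volume.restrict (Set.Icc (0 : ℝ) 1))
    (hξθ : IndepFun (fun ω t => ξ (t + 1) ω) (fun ω t => θ (t + 1) ω) P)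
    (hint : Integrable (fun ω => (ξ 1 ω : ℝ)) P) {r : ℕ} (hr : 1 ≤ r)
    (hpos : 0 < P {ω | ξ 1 ω = r}) :
    ∀ᵐ ω ∂P, ∀ N, ∃ t, N ≤ t ∧
      IsRenewalTime (fun s => ξ s ω) (fun s => θ s ω) r (t + 1) := by
  have hind : ∀ t, IndepFun (ξ (t + 1)) (θ (t + 1)) P := fun t =>
    hξθ.comp (measurable_pi_apply t) (measurable_pi_apply t)
  have hident : ∀ t, IdentDistrib (fun ω => (ξ (t + 1) ω, θ (t + 1) ω))
      (fun ω => (ξ (0 + 1) ω, θ (0 + 1) ω)) P P := fun t =>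
    (hξ_ident t).prodMk ⟨(hθ_meas t).aemeasurable, (hθ_meas 0).aemeasurable,
      (hθ_unif t).trans (hθ_unif 0).symm⟩ (hind t) (hind 0)
  have hθ_pos : P (θ 1 ⁻¹' {x : ℝ | x * (3 * r : ℕ) < 1}) ≠ 0 := by
    have hm : MeasurableSet {x : ℝ | x * (3 * r : ℕ) < 1} :=
      measurableSet_lt (measurable_id.mul_const _) measurable_const
    have hr0 : (0 : ℝ) < (3 * r : ℕ) := Nat.cast_pos.2 (by omega)
    have hr1 : (1 : ℝ) ≤ (3 * r : ℕ) := Nat.one_le_cast.2 (by omega)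
    rw [← Measure.map_apply (hθ_meas 0) hm, hθ_unif 0, Measure.restrict_apply hm]
    have hsub : Set.Ioo (0 : ℝ) (1 / (3 * r : ℕ)) ⊆
        {x : ℝ | x * (3 * r : ℕ) < 1} ∩ Set.Icc 0 1 := fun x hx =>
      ⟨(lt_div_iff₀ hr0).1 hx.2, hx.1.le, hx.2.le.trans ((div_le_one hr0).2 hr1)⟩
    refine ((measure_mono hsub).trans_lt' ?_).ne'
    rw [Real.volume_Ioo, ENNReal.ofReal_pos, sub_zero]
    positivity
  have h := ae_frequently_pattern (Z := fun t ω => (ξ (t + 1) ω, θ (t + 1) ω))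
    (A := renewalSet r) (fun t => (hξ_meas t).prodMk (hθ_meas t))
    (iIndepFun.prodMk_of_indepFun hξ_meas hθ_meas hξ_indep hθ_indep hξθ) hident
    (measurableSet_renewalSet r) ?_ ?_
  · filter_upwards [h] with ω hω N
    obtain ⟨t, ht, hs⟩ := hω N
    exact ⟨t, ht, fun s => by simpa only [add_right_comm t 1 s] using hs s⟩
  · intro s
    unfold renewalSet
    split_ifs with hs
    · have hmul := indepFun_iff_measure_inter_preimage_eq_mul.1 (hind 0) {r}
        {x : ℝ | x * (3 * r : ℕ) < 1} (measurableSet_singleton r)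
        (measurableSet_lt (measurable_id.mul_const _) measurable_const)
      exact hmul ▸ mul_ne_zero hpos.ne' hθ_pos
    -- For `s ≥ 3r` the bound `s - 2r` is at least `r`.
    · have hsub : {ω | ξ 1 ω = r} ⊆ (fun ω => (ξ (0 + 1) ω, θ (0 + 1) ω)) ⁻¹'
          (Set.Iic (s - 2 * r) ×ˢ Set.univ) := by
        intro ω hω
        simp only [Set.mem_ofPred_eq, Set.mem_preimage, Set.mem_prod, Set.mem_Iic, Set.mem_univ,
          and_true, zero_add] at hω ⊢
        omega
      exact (hpos.trans_le (measure_mono hsub)).ne'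
  -- Beyond the run, the failure event at offset `s + 3r` is `ξ > s + r`.
  · rw [← summable_nat_add_iff (3 * r)]
    refine ((summable_nat_add_iff r).2 (summable_measureReal_lt hint)).congr fun s => ?_
    congr 1
    ext ω
    rw [renewalSet, if_neg (by omega)]
    simp only [Set.mem_ofPred_eq, Set.mem_preimage, Set.mem_compl_iff, Set.mem_prod, Set.mem_Iic,
      Set.mem_univ, and_true, zero_add]
    omega

end Probability

theorem theorem2p2 {Ω : Type*} [MeasurableSpace Ω]
    (P : MeasureTheory.Measure Ω) [MeasureTheory.IsProbabilityMeasure P]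
    -- delays `ξ 1, ξ 2, …` and edge randomness `θ 1, θ 2, …`; index `0` is not used
    (ξ : ℕ → Ω → ℕ) (θ : ℕ → Ω → ℝ)
    (hξ_meas : ∀ t, Measurable (ξ (t + 1)))
    (hθ_meas : ∀ t, Measurable (θ (t + 1)))
    (hξ_indep : ProbabilityTheory.iIndepFun (fun t => ξ (t + 1)) P)
    (hξ_ident : ∀ t, ProbabilityTheory.IdentDistrib (ξ (t + 1)) (ξ 1) P P)
    (hθ_indep : ProbabilityTheory.iIndepFun (fun t => θ (t + 1)) P)
    (hθ_unif : ∀ t, P.map (θ (t + 1)) = MeasureTheory.volume.restrict (Set.Icc (0 : ℝ) 1))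
    (hξθ : ProbabilityTheory.IndepFun (fun ω t => ξ (t + 1) ω) (fun ω t => θ (t + 1) ω) P)
    (hξ_pos : ∀ᵐ ω ∂P, 1 ≤ ξ 1 ω)
    (δ : ℝ) (hδ : 0 < δ)
    (hξ_moment : MeasureTheory.Integrable (fun ω => (ξ 1 ω : ℝ) ^ (1 + δ)) P) :
    (∀ᵐ ω ∂P, ∃ G : MarkedDigraph, G.IsBlockDAG ∧
      Filter.Tendsto
        (fun t => MarkedDigraph.dStar
          (MarkedDigraph.acm MarkedDigraph.nakamoto (fun s => ξ s ω) (fun s => θ s ω) t) G)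
        Filter.atTop (nhds 0) ∧
      G.OneEnded ∧ G.IsRootedTree ∧ {v | G.Confirmed v}.Infinite) ∧
    (∀ᵐ ω ∂P, {t | 1 ≤ t ∧
      IsRegenerationInterval (fun s => ξ s ω) (minDelay P (ξ 1)) t ∧
      IsRegenerationInterval (fun s => ξ s ω) (minDelay P (ξ 1))
        (t + minDelay P (ξ 1))}.Infinite) := by
  have hint := integrable_natCast_of_rpow (hξ_meas 0) (by linarith) hξ_moment
  have hr := one_le_minDelay hξ_pos
  have hren := ae_frequently_isRenewalTime hξ_meas hθ_meas hξ_indep hξ_ident hθ_indep hθ_unif hξθ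
    hint hr (measure_minDelay_pos (P := P) (ξ 1))
  constructor
  · filter_upwards [hren] with ω hω
    refine MarkedDigraph.exists_limit_of_renewalTimes hr fun N => ?_
    obtain ⟨t, ht, h⟩ := hω N
    exact ⟨t + 1, by omega, h⟩
  · filter_upwards [hren] with ω hω
    refine Set.infinite_of_not_bddAbove ?_
    rintro ⟨B, hB⟩
    obtain ⟨t, ht, h⟩ := hω B
    have : t + 1 ≤ B := hB ⟨by omega, h.isRegenerationInterval, h.isRegenerationInterval_add⟩
    omega
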